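/- Let $\mathbb{D}=\{z\in\mathbb{C}:|z|<1\}$ and let $\mu$ be a non-trivial (i.e., with infinite support) Borel probability measure on the unit circle $\partial\mathbb{D}$. For $n\ge 0$ let $\Phi_n$ be the monic orthogonal polynomial of degree $n$ for $\mu$, that is, the monic polynomial of degree $n$ with $\int \overline{z^m}\,\Phi_n(z)\,d\mu(z)=0$ for $0\le m<n$. Writing $\Phi_n(z)=\sum_{m=0}^n\kappa_{n,m}z^m$, let $\Phi_n^*(z)=\sum_{m=0}^n\overline{\kappa_{n,n-m}}\,z^m$ be the reversed polynomial, and set $\Phi_n^*\equiv 1$ for integers $n\le -1$. Let $\alpha_n=-\overline{\Phi_{n+1}(0)}$ $(n\ge 0)$ be the Verblunsky coefficients of $\mu$, and set $\alpha_{-1}=-1$ and $\alpha_n=0$ for $n\le -2$. For $n\in\mathbb{Z}$ put $$\Omega_n=\frac{\Phi_{n+1}^*}{\Phi_n^*}.$$ **Theorem.** Let $\{j_n\}_{n\ge 0}$ be a (not necessarily strictly) increasing sequence of integers and let $k'\in\mathbb{Z}\cup\{\infty\}$. Then the following are equivalent: 1. for every integer $k<k'$, the functions $\Omega_{k+j_n}$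 converge, as $n\to\infty$, uniformly on compact subsets of $\mathbb{D}$; 2. for every integer $\ell\ge 1$ and every integer $k<k'$ there is $c_{k,\ell}\in\overline{\mathbb{D}}$ such that $$\lim_{n\to\infty}\alpha_{k+j_n}\,\overline{\alpha_{k+j_n-\ell}}=c_{k,\ell}.$$ -/

import Mathlib

open Polynomial MeasureTheory Filter Topology

namespace OPUC

/-- The unit circle `{z ∈ ℂ : |z| = 1}`, with its Borel sigma-algebra. -/
abbrev UnitCircle : Type := Metric.sphere (0 : ℂ) 1

/-- The `L²(μ)` inner product of polynomials, `⟨p, q⟩ = ∫ conj (p(z)) q(z) dμ(z)` over the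
unit circle. -/
noncomputable def ip (μ : Measure UnitCircle) (p q : ℂ[X]) : ℂ :=
  ∫ z : UnitCircle, (starRingEnd ℂ) (p.eval (z : ℂ)) * q.eval (z : ℂ) ∂μ

/-- The monic orthogonal polynomials `Φ_n` of `μ`: the (unnormalized) Gram-Schmidt procedure
applied to `1, z, z², …`. See `monic_Phi`, `natDegree_Phi` and `ip_Phi_eq_zero`, which say that
`Φ_n` is monic of degree `n` and orthogonal to all polynomials of smaller degree. -/
noncomputable def Phi (μ : Measure UnitCircle) (n : ℕ) : ℂ[X] :=
  X ^ n - ∑ j : Fin n, C (ip μ (Phi μ j) (X ^ n) / ip μ (Phi μ j) (Phi μ j)) * Phi μ j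
termination_by n
decreasing_by all_goals exact j.2

/-- The reversed polynomials `Φ_n^*`. For `n ≥ 0` the coefficient of `z^m` in `Φ_n^*` is the
complex conjugate of the coefficient of `z^(n-m)` in `Φ_n`; for `n < 0`, `Φ_n^* = 1`. -/
noncomputable def PhiStar (μ : Measure UnitCircle) : ℤ → ℂ[X]
  | Int.ofNat n => ((Phi μ n).map (starRingEnd ℂ)).reflect n
  | Int.negSucc _ => 1

/-- The Verblunsky coefficients: `α_n = -conj (Φ_{n+1}(0))` for `n ≥ 0`, extended by
`α_{-1} = -1` and `α_n = 0` for `n ≤ -2`. -/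
noncomputable def verblunsky (μ : Measure UnitCircle) : ℤ → ℂ
  | Int.ofNat n => -(starRingEnd ℂ) ((Phi μ (n + 1)).eval 0)
  | Int.negSucc 0 => -1
  | Int.negSucc (_ + 1) => 0

/-- The ratio `Ω_n = Φ_{n+1}^* / Φ_n^*`, as a function on `ℂ`. -/
noncomputable def ratio (μ : Measure UnitCircle) (n : ℤ) (z : ℂ) : ℂ :=
  (PhiStar μ (n + 1)).eval z / (PhiStar μ n).eval z

/-- The sequence of functions `F` converges, to some limit function, uniformly on compact
subsets of the open unit disk. -/
def ConvergesOnCompacts (F : ℕ → ℂ → ℂ) : Prop :=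
  ∃ G : ℂ → ℂ, ∀ K : Set ℂ, IsCompact K → K ⊆ Metric.ball (0 : ℂ) 1 →
    TendstoUniformlyOn F G atTop K

theorem degree_C_mul_le' (c : ℂ) (p : ℂ[X]) : (C c * p).degree ≤ p.degree := by
  rw [← smul_eq_C_mul]
  exact degree_smul_le c p

theorem Phi_eq (μ : Measure UnitCircle) (n : ℕ) : Phi μ n =
    X ^ n - ∑ j : Fin n,
      C (ip μ (Phi μ j) (X ^ n) / ip μ (Phi μ j) (Phi μ j)) * Phi μ j := by
  conv_lhs => rw [Phi]

theorem degree_Phi_sum_lt (μ : Measure UnitCircle) (n : ℕ)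
    (ih : ∀ m < n, (Phi μ m).degree = m) :
    (∑ j : Fin n, C (ip μ (Phi μ j) (X ^ n) / ip μ (Phi μ j) (Phi μ j)) * Phi μ j).degree
      < (n : WithBot ℕ) := by
  refine (degree_sum_le _ _).trans_lt ((Finset.sup_lt_iff (WithBot.bot_lt_coe n)).2 ?_)
  intro j _
  refine (degree_C_mul_le' _ _).trans_lt ?_
  rw [ih j j.2]
  exact Nat.cast_lt.2 j.2

theorem degree_Phi (μ : Measure UnitCircle) (n : ℕ) : (Phi μ n).degree = n := by
  induction n using Nat.strong_induction_on with
  | _ n ih =>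
    rw [Phi_eq, degree_sub_eq_left_of_degree_lt] <;> rw [degree_X_pow]
    exact degree_Phi_sum_lt μ n ih

theorem natDegree_Phi (μ : Measure UnitCircle) (n : ℕ) : (Phi μ n).natDegree = n :=
  natDegree_eq_of_degree_eq_some (degree_Phi μ n)

theorem monic_Phi (μ : Measure UnitCircle) (n : ℕ) : (Phi μ n).Monic := by
  rw [Phi_eq]
  apply monic_X_pow_sub
  have h := degree_Phi_sum_lt μ n (fun m _ => degree_Phi μ m)
  exact h

theorem integrable_ip (μ : Measure UnitCircle) [IsFiniteMeasure μ] (p q : ℂ[X]) :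
    Integrable (fun z : UnitCircle => (starRingEnd ℂ) (p.eval (z : ℂ)) * q.eval (z : ℂ)) μ := by
  have hc : Continuous
      (fun z : UnitCircle => (starRingEnd ℂ) (p.eval (z : ℂ)) * q.eval (z : ℂ)) := by
    fun_prop
  exact hc.integrable_of_hasCompactSupport (HasCompactSupport.of_compactSpace _)

theorem ip_self_ne_zero (μ : Measure UnitCircle) [IsFiniteMeasure μ] (hμ : μ.support.Infinite)
    {p : ℂ[X]} (hp : p ≠ 0) : ip μ p p ≠ 0 := by
  intro h
  have h1 : ∀ z : UnitCircle, (starRingEnd ℂ) (p.eval (z : ℂ)) * p.eval (z : ℂ)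
      = ((‖p.eval (z : ℂ)‖ ^ 2 : ℝ) : ℂ) := fun z => by
    rw [mul_comm, Complex.mul_conj, Complex.normSq_eq_norm_sq]
  have hint := integrable_ip μ p p
  simp only [ip, h1] at h hint
  rw [integral_complex_ofReal, Complex.ofReal_eq_zero] at h
  have hint' : Integrable (fun z : UnitCircle => ‖p.eval (z : ℂ)‖ ^ 2) μ := by
    simpa only [RCLike.re_to_complex, Complex.ofReal_re] using hint.re
  rw [integral_eq_zero_iff_of_nonneg (fun z => by positivity) hint'] at h
  have hcl : IsClosed {z : UnitCircle | p.eval (z : ℂ) = 0} :=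
    isClosed_eq (by fun_prop) continuous_const
  have hsub : μ.support ⊆ {z : UnitCircle | p.eval (z : ℂ) = 0} := by
    refine Measure.support_subset_of_isClosed hcl ?_
    filter_upwards [h] with z hz
    simpa using hz
  refine hμ (Set.Finite.subset ?_ hsub)
  have hf : ({z : ℂ | p.IsRoot z}).Finite := finite_setOfPred_isRoot hp
  exact hf.preimage (Subtype.val_injective.injOn)

theorem ip_add_right (μ : Measure UnitCircle) [IsFiniteMeasure μ] (p q r : ℂ[X]) :
    ip μ p (q + r) = ip μ p q + ip μ p r := by
  simp only [ip, eval_add, mul_add]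
  exact integral_add (integrable_ip μ p q) (integrable_ip μ p r)

theorem ip_C_mul_right (μ : Measure UnitCircle) (p q : ℂ[X]) (c : ℂ) :
    ip μ p (C c * q) = c * ip μ p q := by
  simp only [ip, eval_mul, eval_C, ← integral_const_mul]
  congr 1; ext z; ring

theorem ip_conj (μ : Measure UnitCircle) (p q : ℂ[X]) :
    (starRingEnd ℂ) (ip μ p q) = ip μ q p := by
  simp only [ip, ← integral_conj]
  congr 1; ext z; simp [mul_comm]

theorem ip_Phi_Phi (μ : Measure UnitCircle) [IsFiniteMeasure μ] (hμ : μ.support.Infinite)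
    (n : ℕ) : ∀ m < n, ip μ (Phi μ m) (Phi μ n) = 0 := by
  induction n using Nat.strong_induction_on with
  | _ n ih =>
    intro m hm
    have hz : ∀ s : Finset (Fin n), ∀ f : Fin n → ℂ,
        ip μ (Phi μ m) (∑ j ∈ s, C (f j) * Phi μ j)
          = ∑ j ∈ s, f j * ip μ (Phi μ m) (Phi μ j) := by
      intro s f
      induction s using Finset.induction_on with
      | empty => simp [ip]
      | insert a s ha hs => rw [Finset.sum_insert ha, Finset.sum_insert ha, ip_add_right, hs,
          ip_C_mul_right]
    have hsub : ∀ q r : ℂ[X], ip μ (Phi μ m) (q - r) = ip μ (Phi μ m) q - ip μ (Phi μ m) r := by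
      intro q r
      have := ip_add_right μ (Phi μ m) (q - r) r
      rw [sub_add_cancel] at this
      rw [this]; ring
    have h0 : ip μ (Phi μ m) (Phi μ m) ≠ 0 := ip_self_ne_zero μ hμ (monic_Phi μ m).ne_zero
    rw [Phi_eq μ n, hsub, hz, Finset.sum_eq_single (⟨m, hm⟩ : Fin n)]
    · rw [div_mul_cancel₀ _ h0, sub_self]
    · intro j _ hj
      have hne : (j : ℕ) ≠ m := fun h => hj (Fin.ext h)
      rcases lt_or_gt_of_ne hne with hlt | hlt
      · rw [← ip_conj μ (Phi μ j) (Phi μ m), ih m hm j hlt]; simp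
      · rw [ih j j.2 m hlt]; simp
    · simp

/-- `Φ_n` is orthogonal to every polynomial of degree less than `n`. -/
theorem ip_Phi_eq_zero (μ : Measure UnitCircle) [IsFiniteMeasure μ] (hμ : μ.support.Infinite)
    (n : ℕ) (p : ℂ[X]) (hp : p.degree < n) : ip μ p (Phi μ n) = 0 := by
  have key : ∀ d : ℕ, ∀ p : ℂ[X], p.degree < d → d ≤ n → ip μ (Phi μ n) p = 0 := by
    intro d
    induction d with
    | zero =>
      intro p hp _
      have : p = 0 := by
        rw [← degree_eq_bot]; simpa using hp
      simp [this, ip]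
    | succ d ihd =>
      intro p hp hd
      have hsplit : p = (p - C (p.coeff d) * Phi μ d) + C (p.coeff d) * Phi μ d := by ring
      rw [hsplit, ip_add_right, ip_C_mul_right, ← ip_conj μ (Phi μ d), ip_Phi_Phi μ hμ n d hd,
        ihd _ _ (by omega)]
      · simp
      · rw [degree_lt_iff_coeff_zero] at hp ⊢
        intro k hk
        rcases hk.eq_or_lt with rfl | hk
        · have := (monic_Phi μ d).coeff_natDegree
          rw [natDegree_Phi] at this
          simp [this]
        · have h2 : (Phi μ d).coeff k = 0 :=
            coeff_eq_zero_of_natDegree_lt (by rw [natDegree_Phi]; exact hk)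
          simp [h2, hp k hk]
  rw [← ip_conj, key n p hp le_rfl, map_zero]

end OPUC

/-! Two facts carry the proof. First, every `Ω_m` is holomorphic on the disk and bounded there by 2,
because `Ω_m = 1 - α_m z Φ_m / Φ_m^*` with `|Φ_m| ≤ |Φ_m^*|` and `|α_m| ≤ 1`. By Cauchy's estimates,
locally uniform convergence is therefore the same as convergence of each Taylor coefficient at 0
(`convergesOnCompacts_ratio_iff`).

Second, unrolling Szegő's recursion for `Φ_m` gives `Ω_m = 1 + ∑_{i<L} α_m conj(α_{m-i-1}) z^{i+1}
Φ_{m-i-1}^* / Φ_m^* + O(z^{L+1})`, where `Φ_{m-ℓ}^* / Φ_m^*` is the reciprocal of `Ω_{m-1} ⋯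
Ω_{m-ℓ}` and has constant term 1. So the coefficient of `z^{L+1}` in `Ω_m` is `α_m conj(α_{m-L-1})`
plus an expression in products with smaller lag and coefficients of order at most `L` of earlier
ratios (`coeff_succ_taylorSeries_ratio`).

Induction on the order, over all `k < k'` at once, transfers convergence either way: only smaller
indices enter, and `k < k'` is preserved by decreasing `k`. -/

namespace OPUC

/-! ### Taylor coefficients and locally uniform convergence on the disk. -/

/-- The Taylor expansion of `f` at the origin, as a formal power series. -/
noncomputable def taylorSeries (f : ℂ → ℂ) : PowerSeries ℂ :=
  PowerSeries.mk fun i => ((i.factorial : ℂ))⁻¹ * iteratedDeriv i f 0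

theorem coeff_taylorSeries (f : ℂ → ℂ) (i : ℕ) :
    PowerSeries.coeff i (taylorSeries f) = ((i.factorial : ℂ))⁻¹ * iteratedDeriv i f 0 :=
  PowerSeries.coeff_mk _ _

theorem taylorSeries_mul {f g : ℂ → ℂ} (hf : AnalyticAt ℂ f 0) (hg : AnalyticAt ℂ g 0) :
    taylorSeries (f * g) = taylorSeries f * taylorSeries g := by
  ext
  simp only [coeff_taylorSeries, iteratedDeriv_mul hf.contDiffAt hg.contDiffAt, Finset.mul_sum,
    PowerSeries.coeff_mul, Finset.Nat.sum_antidiagonal_eq_sum_range_succ_mk, Nat.succ_eq_add_one]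
  refine Finset.sum_congr rfl fun i hi ↦ ?_
  rw [Nat.cast_choose _ (by grind)]
  field_simp [Nat.factorial_ne_zero]

theorem taylorSeries_congr {f g : ℂ → ℂ} (h : f =ᶠ[𝓝 0] g) : taylorSeries f = taylorSeries g := by
  ext i
  rw [coeff_taylorSeries, coeff_taylorSeries, h.iteratedDeriv_eq]

theorem iteratedDeriv_eval (p : ℂ[X]) (i : ℕ) :
    iteratedDeriv i (fun z => p.eval z) = fun z => (derivative^[i] p).eval z := by
  induction i with
  | zero => simp
  | succ i ih =>
    rw [iteratedDeriv_succ, ih]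
    ext z
    rw [Polynomial.deriv, Function.iterate_succ_apply']

theorem taylorSeries_eval (p : ℂ[X]) : taylorSeries (fun z => p.eval z) = (p : PowerSeries ℂ) := by
  ext i
  rw [coeff_taylorSeries, iteratedDeriv_eval, Polynomial.coeff_coe]
  beta_reduce
  rw [← coeff_zero_eq_eval_zero, coeff_iterate_derivative]
  simp only [zero_add, Nat.descFactorial_self, nsmul_eq_mul]
  rw [inv_mul_cancel_left₀ (by exact_mod_cast i.factorial_ne_zero)]

theorem hasSum_taylorSeries {f : ℂ → ℂ} (hf : DifferentiableOn ℂ f (Metric.ball 0 1))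
    {z : ℂ} (hz : z ∈ Metric.ball (0 : ℂ) 1) :
    HasSum (fun i => PowerSeries.coeff i (taylorSeries f) * z ^ i) (f z) := by
  have h := Complex.hasSum_taylorSeries_on_ball hf hz
  have hfun : (fun i => PowerSeries.coeff i (taylorSeries f) * z ^ i) =
      fun i : ℕ => ((i.factorial : ℂ))⁻¹ • (z - 0) ^ i • iteratedDeriv i f 0 := by
    funext i
    rw [coeff_taylorSeries, sub_zero, smul_eq_mul, smul_eq_mul]
    ring
  rw [hfun]
  exact h

/-- Cauchy's estimate on the circle of radius `r < 1`. -/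
theorem norm_coeff_taylorSeries_mul_le {f : ℂ → ℂ} (hf : DifferentiableOn ℂ f (Metric.ball 0 1))
    {r M : ℝ} (hr : 0 < r) (hr1 : r < 1) (hM : ∀ z ∈ Metric.closedBall (0 : ℂ) r, ‖f z‖ ≤ M)
    (i : ℕ) : ‖PowerSeries.coeff i (taylorSeries f)‖ * r ^ i ≤ M := by
  have hd : DiffContOnCl ℂ f (Metric.ball 0 r) :=
    hf.diffContOnCl_ball (Metric.closedBall_subset_ball hr1)
  have h := Complex.norm_iteratedDeriv_le_of_forall_mem_sphere_norm_le i hr hd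
    (fun z hz => hM z (Metric.sphere_subset_closedBall hz))
  have hfac : (0 : ℝ) < i.factorial := by exact_mod_cast i.factorial_pos
  rw [le_div_iff₀ (by positivity)] at h
  rw [coeff_taylorSeries, norm_mul, norm_inv, Complex.norm_natCast, mul_assoc,
    inv_mul_le_iff₀ hfac]
  exact h

theorem norm_coeff_taylorSeries_le {f : ℂ → ℂ} (hf : DifferentiableOn ℂ f (Metric.ball 0 1))
    {M : ℝ} (hM : ∀ z ∈ Metric.ball (0 : ℂ) 1, ‖f z‖ ≤ M) (i : ℕ) :
    ‖PowerSeries.coeff i (taylorSeries f)‖ ≤ M := by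
  -- Let `r → 1` in Cauchy's estimate on the circle of radius `r`.
  have hlim : Tendsto (fun r : ℝ => ‖PowerSeries.coeff i (taylorSeries f)‖ * r ^ i) (𝓝[<] 1)
      (𝓝 (‖PowerSeries.coeff i (taylorSeries f)‖ * 1 ^ i)) := by
    refine Tendsto.mono_left ?_ nhdsWithin_le_nhds
    exact Continuous.tendsto (by fun_prop) 1
  rw [one_pow, mul_one] at hlim
  refine le_of_tendsto hlim ?_
  filter_upwards [Ioo_mem_nhdsLT (show (0 : ℝ) < 1 by norm_num)] with r hr
  exact norm_coeff_taylorSeries_mul_le hf hr.1 hr.2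
    (fun z hz => hM z (Metric.closedBall_subset_ball hr.2 hz)) i

theorem taylorSeries_sub {f g : ℂ → ℂ} (hf : AnalyticAt ℂ f 0) (hg : AnalyticAt ℂ g 0) :
    taylorSeries (f - g) = taylorSeries f - taylorSeries g := by
  ext i
  simp only [map_sub, coeff_taylorSeries]
  rw [iteratedDeriv_sub hf.contDiffAt hg.contDiffAt, mul_sub]

/-- For holomorphic functions on the unit disk, uniform convergence on compact sets implies
convergence of the Taylor coefficients. -/
theorem ConvergesOnCompacts.tendsto_coeff {F : ℕ → ℂ → ℂ}
    (hF : ∀ n, DifferentiableOn ℂ (F n) (Metric.ball 0 1)) (h : ConvergesOnCompacts F) (i : ℕ) :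
    ∃ c, Tendsto (fun n => PowerSeries.coeff i (taylorSeries (F n))) atTop (𝓝 c) := by
  obtain ⟨G, hG⟩ := h
  -- Only the Cauchy property on one small disk is needed, so no regularity of `G` enters.
  have hcau := (hG (Metric.closedBall 0 (1 / 2)) (isCompact_closedBall _ _)
    (Metric.closedBall_subset_ball (by norm_num))).uniformCauchySeqOn
  rw [Metric.uniformCauchySeqOn_iff] at hcau
  have han : ∀ n, AnalyticAt ℂ (F n) 0 := fun n =>
    (hF n).analyticAt (Metric.ball_mem_nhds 0 one_pos)
  refine cauchySeq_tendsto_of_complete ?_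
  rw [Metric.cauchySeq_iff]
  intro ε hε
  -- The factor `(1 / 2) ^ i` cancels the `r ^ i` of Cauchy's estimate; halving `ε` makes the final
  -- inequality strict.
  obtain ⟨N, hN⟩ := hcau (ε / 2 * (1 / 2) ^ i) (by positivity)
  refine ⟨N, fun m hm n hn => ?_⟩
  have hle := norm_coeff_taylorSeries_mul_le (f := F m - F n) ((hF m).sub (hF n))
    (r := 1 / 2) (M := ε / 2 * (1 / 2) ^ i) (by norm_num) (by norm_num)
    (fun z hz => by
      have := hN m hm n hn z hz
      rw [dist_eq_norm] at this
      exact this.le) i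
  rw [taylorSeries_sub (han m) (han n), map_sub] at hle
  rw [dist_eq_norm]
  have := le_of_mul_le_mul_right hle (by positivity)
  linarith

/-- For uniformly bounded holomorphic functions on the unit disk, convergence of the Taylor
coefficients implies uniform convergence on compact sets. -/
theorem convergesOnCompacts_of_tendsto_coeff {F : ℕ → ℂ → ℂ} {M : ℝ}
    (hF : ∀ n, DifferentiableOn ℂ (F n) (Metric.ball 0 1))
    (hM : ∀ n, ∀ z ∈ Metric.ball (0 : ℂ) 1, ‖F n z‖ ≤ M)
    (h : ∀ i, ∃ c, Tendsto (fun n => PowerSeries.coeff i (taylorSeries (F n))) atTop (𝓝 c)) :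
    ConvergesOnCompacts F := by
  choose c hc using h
  have hb : ∀ n i, ‖PowerSeries.coeff i (taylorSeries (F n))‖ ≤ M :=
    fun n i => norm_coeff_taylorSeries_le (hF n) (hM n) i
  have hcM : ∀ i, ‖c i‖ ≤ M := fun i => le_of_tendsto (hc i).norm (Eventually.of_forall (hb · i))
  have hM0 : 0 ≤ M := (norm_nonneg _).trans (hcM 0)
  refine ⟨fun z => ∑' i, c i * z ^ i, fun K hK hK1 => ?_⟩
  obtain ⟨r, hr0, hr1, hKr⟩ : ∃ r : ℝ, 0 ≤ r ∧ r < 1 ∧ ∀ z ∈ K, ‖z‖ ≤ r := by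
    rcases K.eq_empty_or_nonempty with rfl | hne
    · exact ⟨0, le_rfl, one_pos, by simp⟩
    · obtain ⟨z, hz, hmax⟩ := hK.exists_isMaxOn hne continuous_norm.continuousOn
      exact ⟨‖z‖, norm_nonneg z, by simpa using hK1 hz, fun w hw => hmax hw⟩
  have hgeo : Summable fun i : ℕ => r ^ i := summable_geometric_of_lt_one hr0 hr1
  have hdiff : ∀ n i,
      ‖PowerSeries.coeff i (taylorSeries (F n)) - c i‖ * r ^ i ≤ 2 * M * r ^ i := fun n i => by
    gcongr
    have := norm_sub_le (PowerSeries.coeff i (taylorSeries (F n))) (c i)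
    linarith [hb n i, hcM i]
  have hsum : ∀ n, Summable fun i =>
      ‖PowerSeries.coeff i (taylorSeries (F n)) - c i‖ * r ^ i := fun n =>
    Summable.of_nonneg_of_le (fun i => by positivity) (hdiff n) (hgeo.mul_left _)
  -- This sum bounds the error at every point of `K` simultaneously; it tends to 0 by dominated
  -- convergence against `2 * M * r ^ i`.
  have hlim : Tendsto (fun n => ∑' i, ‖PowerSeries.coeff i (taylorSeries (F n)) - c i‖ * r ^ i)
      atTop (𝓝 (∑' _ : ℕ, (0 : ℝ))) := by
    refine tendsto_tsum_of_dominated_convergence (hgeo.mul_left (2 * M)) (fun i => ?_)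
      (Eventually.of_forall fun n i => ?_)
    · have h0 := (((hc i).sub_const (c i)).norm).mul_const (r ^ i)
      simpa using h0
    · rw [Real.norm_of_nonneg (by positivity)]
      exact hdiff n i
  rw [tsum_zero] at hlim
  rw [Metric.tendstoUniformlyOn_iff]
  intro ε hε
  filter_upwards [hlim.eventually_lt_const hε] with n hn z hz
  refine lt_of_le_of_lt ?_ hn
  have hzr := hKr z hz
  have hcs : Summable fun i => c i * z ^ i := by
    refine Summable.of_norm_bounded (hgeo.mul_left M) fun i => ?_
    rw [norm_mul, norm_pow]
    gcongr
    exact hcM i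
  have hF' := hasSum_taylorSeries (hF n) (hK1 hz)
  have hd := hF'.sub hcs.hasSum
  rw [dist_comm, dist_eq_norm, ← hd.tsum_eq]
  refine tsum_of_norm_bounded (hsum n).hasSum fun i => ?_
  rw [← sub_mul, norm_mul, norm_pow]
  gcongr

/-! ### Reversal of polynomials and the inner product on the circle. -/

/-- The reversal of degree `n`: the coefficient of `z^m` in `conjReflect n p` is the conjugate of
the coefficient of `z^(n-m)` in `p`. -/
noncomputable def conjReflect (n : ℕ) (p : ℂ[X]) : ℂ[X] :=
  (p.map (starRingEnd ℂ)).reflect n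

theorem natDegree_conjReflect_le {n : ℕ} {p : ℂ[X]} (hp : p.natDegree ≤ n) :
    (conjReflect n p).natDegree ≤ n :=
  natDegree_reflect_le.trans (max_le le_rfl (natDegree_map_le.trans hp))

theorem conjReflect_conjReflect (n : ℕ) (p : ℂ[X]) : conjReflect n (conjReflect n p) = p := by
  rw [conjReflect, conjReflect, reflect_map, reflect_reflect, Polynomial.map_map]
  simp

theorem conjReflect_sub (n : ℕ) (p q : ℂ[X]) :
    conjReflect n (p - q) = conjReflect n p - conjReflect n q := by
  simp [conjReflect, reflect_sub]

theorem conjReflect_C_mul (n : ℕ) (c : ℂ) (p : ℂ[X]) :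
    conjReflect n (C c * p) = C ((starRingEnd ℂ) c) * conjReflect n p := by
  simp [conjReflect]

theorem conjReflect_succ_X_mul {n : ℕ} {p : ℂ[X]} (hp : p.natDegree ≤ n) :
    conjReflect (n + 1) (X * p) = conjReflect n p := by
  rw [conjReflect, conjReflect, add_comm n 1, Polynomial.map_mul, map_X,
    reflect_mul _ _ natDegree_X_le (natDegree_map_le.trans hp), reflect_one_X, one_mul]

theorem conjReflect_succ {n : ℕ} {p : ℂ[X]} (hp : p.natDegree ≤ n) :
    conjReflect (n + 1) p = X * conjReflect n p := by
  have h := reflect_mul (1 : ℂ[X]) (p.map (starRingEnd ℂ)) (F := 1) (G := n) (by simp)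
    (natDegree_map_le.trans hp)
  rwa [one_mul, reflect_one, pow_one, add_comm 1 n] at h

theorem eval_conjReflect {n : ℕ} {p : ℂ[X]} (hp : p.natDegree ≤ n) {z : ℂ} (hz : ‖z‖ = 1) :
    (conjReflect n p).eval z = z ^ n * (starRingEnd ℂ) (p.eval z) := by
  have hz0 : z ≠ 0 := by rintro rfl; simp at hz
  have hinv : (starRingEnd ℂ) z = z⁻¹ := (Complex.inv_eq_conj hz).symm
  -- `eval₂_reflect_mul_pow` evaluates the reflection at the inverse of its point; using `z⁻¹` as
  -- that point makes this `z`.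
  let _ : Invertible z⁻¹ := invertibleOfNonzero (inv_ne_zero hz0)
  have h := eval₂_reflect_mul_pow (RingHom.id ℂ) z⁻¹ n (p.map (starRingEnd ℂ))
    (natDegree_map_le.trans hp)
  rw [invOf_eq_inv, inv_inv, eval₂_id, eval₂_id, ← hinv, eval_map_apply, hinv] at h
  have hpow : z ^ n * z⁻¹ ^ n = 1 := by rw [← mul_pow, mul_inv_cancel₀ hz0, one_pow]
  rw [conjReflect, ← h]
  linear_combination -(eval z (reflect n (p.map (starRingEnd ℂ)))) * hpow

variable (μ : Measure UnitCircle)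

/-- On the circle reversal is `p ↦ z^n conj p`, which is antiunitary, so the arguments swap. -/
theorem ip_conjReflect {n : ℕ} {p q : ℂ[X]} (hp : p.natDegree ≤ n) (hq : q.natDegree ≤ n) :
    ip μ (conjReflect n p) (conjReflect n q) = ip μ q p := by
  refine integral_congr_ae (Eventually.of_forall fun z => ?_)
  have hz : ‖(z : ℂ)‖ = 1 := by simp
  have h1 : (starRingEnd ℂ) (z : ℂ) ^ n * (z : ℂ) ^ n = 1 := by
    rw [← mul_pow, ← Complex.normSq_eq_conj_mul_self, Complex.normSq_eq_norm_sq, hz]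
    simp
  simp only [eval_conjReflect hp hz, eval_conjReflect hq hz, map_mul, map_pow, Complex.conj_conj]
  linear_combination ((starRingEnd ℂ) (q.eval (z : ℂ)) * p.eval (z : ℂ)) * h1

theorem ip_X_mul (p q : ℂ[X]) : ip μ (X * p) (X * q) = ip μ p q := by
  refine integral_congr_ae (Eventually.of_forall fun z => ?_)
  have hz : ‖(z : ℂ)‖ = 1 := by simp
  have h1 : (starRingEnd ℂ) (z : ℂ) * (z : ℂ) = 1 := by
    rw [← Complex.normSq_eq_conj_mul_self, Complex.normSq_eq_norm_sq, hz]
    simp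
  simp only [eval_mul, eval_X, map_mul]
  linear_combination ((starRingEnd ℂ) (p.eval (z : ℂ)) * q.eval (z : ℂ)) * h1

theorem ip_sub_right [IsFiniteMeasure μ] (p q r : ℂ[X]) :
    ip μ p (q - r) = ip μ p q - ip μ p r := by
  rw [eq_sub_iff_add_eq, ← ip_add_right, sub_add_cancel]

/-! ### Szegő's recursion and the bound on the Verblunsky coefficients. -/

/-- `Φ_n^*` is orthogonal to `z, …, z^n`. -/
theorem ip_X_mul_conjReflect_Phi [IsFiniteMeasure μ] (hμ : μ.support.Infinite) {n : ℕ} {p : ℂ[X]}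
    (hp : p.degree < n) : ip μ (X * p) (conjReflect n (Phi μ n)) = 0 := by
  obtain _ | n := n
  · have : p = 0 := by rw [← degree_eq_bot]; simpa using hp
    simp [this, ip]
  have hp' : p.natDegree ≤ n := by
    rw [natDegree_le_iff_coeff_eq_zero]
    exact fun m hm => degree_lt_iff_coeff_zero _ _ |>.1 hp m hm
  -- `X * p` is the degree `n + 1` reversal of a polynomial of degree at most `n`, so antiunitarity
  -- reduces the claim to the orthogonality of `Φ_{n+1}`.
  rw [← conjReflect_conjReflect n p, ← conjReflect_succ (natDegree_conjReflect_le hp'),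
    ip_conjReflect _ ((natDegree_conjReflect_le hp').trans n.le_succ) (natDegree_Phi μ _).le,
    ← ip_conj, ip_Phi_eq_zero μ hμ, map_zero]
  exact (degree_le_of_natDegree_le (natDegree_conjReflect_le hp')).trans_lt
    (by exact_mod_cast n.lt_succ_self)

theorem coeff_zero_conjReflect_Phi (n : ℕ) : (conjReflect n (Phi μ n)).coeff 0 = 1 := by
  have h := (monic_Phi μ n).coeff_natDegree
  rw [natDegree_Phi] at h
  simp [conjReflect, h]

/-- Szegő's recursion. -/
theorem Phi_succ [IsFiniteMeasure μ] (hμ : μ.support.Infinite) (n : ℕ) :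
    Phi μ (n + 1) = X * Phi μ n + C ((Phi μ (n + 1)).coeff 0) * conjReflect n (Phi μ n) := by
  set q := Phi μ (n + 1) - X * Phi μ n - C ((Phi μ (n + 1)).coeff 0) * conjReflect n (Phi μ n)
    with hq
  have hq0 : q.coeff 0 = 0 := by simp [hq, coeff_zero_conjReflect_Phi]
  obtain ⟨r, hr⟩ := X_dvd_iff.2 hq0
  have hlead : ∀ m, (Phi μ m).coeff m = 1 := fun m => by
    have h := (monic_Phi μ m).coeff_natDegree
    rwa [natDegree_Phi] at h
  have hrdeg : r.degree < n := by
    rw [degree_lt_iff_coeff_zero]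
    intro m hm
    have h2 : (conjReflect n (Phi μ n)).coeff (m + 1) = 0 := coeff_eq_zero_of_natDegree_lt
      ((natDegree_conjReflect_le (natDegree_Phi μ n).le).trans_lt (Nat.lt_succ_of_le hm))
    rw [← coeff_X_mul, ← hr, hq]
    rcases hm.eq_or_lt with rfl | hm
    · simp [hlead, h2]
    · have h3 : (Phi μ (n + 1)).coeff (m + 1) = 0 :=
        coeff_eq_zero_of_natDegree_lt (by rw [natDegree_Phi]; omega)
      have h4 : (Phi μ n).coeff m = 0 :=
        coeff_eq_zero_of_natDegree_lt (by rw [natDegree_Phi]; omega)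
      simp [h2, h3, h4]
  have hXr : (X * r).degree < ((n + 1 : ℕ) : WithBot ℕ) := by
    rw [degree_lt_iff_coeff_zero] at hrdeg ⊢
    intro m hm
    obtain _ | m := m
    · omega
    · rw [coeff_X_mul, hrdeg m (by omega)]
  -- The defect in the recursion is `X * r` with `deg r < n`. Each of its three terms is orthogonal
  -- to `X * r`, so it is orthogonal to itself.
  have hr0 : X * r = 0 := by
    by_contra hne
    refine ip_self_ne_zero μ hμ hne ?_
    conv_lhs => enter [3]; rw [← hr, hq]
    rw [ip_sub_right, ip_sub_right, ip_Phi_eq_zero μ hμ _ _ hXr, ip_X_mul,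
      ip_Phi_eq_zero μ hμ _ _ hrdeg, ip_C_mul_right, ip_X_mul_conjReflect_Phi μ hμ hrdeg]
    simp
  rw [hr0, hq] at hr
  linear_combination hr

theorem ip_self_eq (p : ℂ[X]) :
    ip μ p p = ((∫ z : UnitCircle, ‖p.eval (z : ℂ)‖ ^ 2 ∂μ : ℝ) : ℂ) := by
  rw [← integral_complex_ofReal]
  refine integral_congr_ae (Eventually.of_forall fun z => ?_)
  simp only
  rw [← Complex.normSq_eq_conj_mul_self, Complex.normSq_eq_norm_sq]

/-- Szegő's recursion and orthogonality give `‖Φ_{n+1}‖² = (1 - |a|²) ‖Φ_n‖²` with `a = Φ_{n+1}(0)`;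
the left side is nonnegative and `‖Φ_n‖² > 0`. -/
theorem norm_coeff_zero_Phi_succ_le [IsFiniteMeasure μ] (hμ : μ.support.Infinite) (n : ℕ) :
    ‖(Phi μ (n + 1)).coeff 0‖ ≤ 1 := by
  set a := (Phi μ (n + 1)).coeff 0 with ha
  have hrec := Phi_succ μ hμ n
  rw [← ha] at hrec
  have hdeg : (conjReflect n (Phi μ n)).degree < ((n + 1 : ℕ) : WithBot ℕ) :=
    (degree_le_of_natDegree_le (natDegree_conjReflect_le (natDegree_Phi μ n).le)).trans_lt
      (by exact_mod_cast n.lt_succ_self)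
  have horth := ip_Phi_eq_zero μ hμ (n + 1) _ hdeg
  have hnorm : ip μ (conjReflect n (Phi μ n)) (conjReflect n (Phi μ n))
      = ip μ (Phi μ n) (Phi μ n) :=
    ip_conjReflect μ (natDegree_Phi μ n).le (natDegree_Phi μ n).le
  have hX : ip μ (conjReflect n (Phi μ n)) (X * Phi μ n) = - (a * ip μ (Phi μ n) (Phi μ n)) := by
    rw [hrec, ip_add_right, ip_C_mul_right, hnorm] at horth
    linear_combination horth
  have hself : ip μ (Phi μ (n + 1)) (Phi μ (n + 1))
      = (1 - a * (starRingEnd ℂ) a) * ip μ (Phi μ n) (Phi μ n) := by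
    have h1 : ip μ (Phi μ (n + 1)) (Phi μ (n + 1)) = ip μ (Phi μ (n + 1)) (X * Phi μ n) := by
      conv_lhs => enter [3]; rw [hrec]
      rw [ip_add_right, ip_C_mul_right, ← ip_conj μ (conjReflect n (Phi μ n)), horth]
      simp
    rw [h1, ← ip_conj]
    conv_lhs => enter [2, 3]; rw [hrec]
    rw [ip_add_right, ip_C_mul_right, ip_X_mul, ← ip_conj μ (conjReflect n (Phi μ n)), hX]
    simp only [map_add, map_mul, map_neg, Complex.conj_conj, ip_conj]
    ring
  have hpos : ∀ p : ℂ[X], 0 ≤ ∫ z : UnitCircle, ‖p.eval (z : ℂ)‖ ^ 2 ∂μ :=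
    fun p => integral_nonneg fun z => by positivity
  have hne := ip_self_ne_zero μ hμ (monic_Phi μ n).ne_zero
  rw [ip_self_eq, Complex.ofReal_ne_zero] at hne
  have hlt := lt_of_le_of_ne (hpos (Phi μ n)) hne.symm
  have h0 := hpos (Phi μ (n + 1))
  rw [Complex.mul_conj, ip_self_eq, ip_self_eq, Complex.normSq_eq_norm_sq] at hself
  norm_cast at hself
  rw [hself] at h0
  have := nonneg_of_mul_nonneg_left h0 hlt
  nlinarith [norm_nonneg a]

/-! ### The recursion over all integers, and bounds for the ratios. -/

/-- The monic orthogonal polynomials indexed by the integers, with `Φ_n = 0` for `n < 0`. -/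
noncomputable def PhiInt : ℤ → ℂ[X]
  | Int.ofNat n => Phi μ n
  | Int.negSucc _ => 0

theorem Phi_zero : Phi μ 0 = 1 := by rw [Phi_eq]; simp

theorem PhiStar_ofNat (n : ℕ) : PhiStar μ (Int.ofNat n) = conjReflect n (Phi μ n) := rfl

theorem PhiStar_zero : PhiStar μ 0 = 1 := by
  rw [show (0 : ℤ) = Int.ofNat 0 from rfl, PhiStar_ofNat, Phi_zero]
  simp [conjReflect]

theorem verblunsky_ofNat (n : ℕ) :
    verblunsky μ (Int.ofNat n) = -(starRingEnd ℂ) ((Phi μ (n + 1)).coeff 0) := by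
  rw [coeff_zero_eq_eval_zero]; rfl

theorem coeff_zero_PhiStar (m : ℤ) : (PhiStar μ m).coeff 0 = 1 := by
  obtain n | n := m
  · rw [PhiStar_ofNat, coeff_zero_conjReflect_Phi]
  · simp [PhiStar]

theorem norm_verblunsky_le [IsFiniteMeasure μ] (hμ : μ.support.Infinite) (m : ℤ) :
    ‖verblunsky μ m‖ ≤ 1 := by
  obtain n | _ | n := m
  · rw [verblunsky_ofNat, norm_neg, RCLike.norm_conj]
    exact norm_coeff_zero_Phi_succ_le μ hμ n
  · simp [verblunsky]
  · simp [verblunsky]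

/-- The conventions make this hold for every integer: at `m = -1`, the values `α_{-1} = -1`, `Φ_{-1}
= 0` and `Φ_{-1}^* = 1` produce `Φ_0 = 1`; below that both sides vanish. -/
theorem PhiInt_succ [IsFiniteMeasure μ] (hμ : μ.support.Infinite) (m : ℤ) :
    PhiInt μ (m + 1) =
      X * PhiInt μ m - C ((starRingEnd ℂ) (verblunsky μ m)) * PhiStar μ m := by
  obtain n | _ | n := m
  · rw [verblunsky_ofNat, PhiStar_ofNat]
    change Phi μ (n + 1) = X * Phi μ n - _
    conv_lhs => rw [Phi_succ μ hμ n]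
    simp
  · change Phi μ 0 = X * 0 - C ((starRingEnd ℂ) (-1)) * 1
    simp [Phi_zero]
  · change 0 = X * 0 - C ((starRingEnd ℂ) 0) * 1
    simp

theorem PhiStar_succ [IsFiniteMeasure μ] (hμ : μ.support.Infinite) (m : ℤ) :
    PhiStar μ (m + 1) = PhiStar μ m - C (verblunsky μ m) * X * PhiInt μ m := by
  obtain n | _ | n := m
  · rw [verblunsky_ofNat]
    change conjReflect (n + 1) (Phi μ (n + 1)) = conjReflect n (Phi μ n) - _ * X * Phi μ n
    have h : Phi μ (n + 1) =
        X * Phi μ n - C (-(Phi μ (n + 1)).coeff 0) * conjReflect n (Phi μ n) := by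
      conv_lhs => rw [Phi_succ μ hμ n]
      simp
    conv_lhs => rw [h]
    rw [conjReflect_sub, conjReflect_C_mul, conjReflect_succ_X_mul (natDegree_Phi μ n).le,
      conjReflect_succ (natDegree_conjReflect_le (natDegree_Phi μ n).le),
      conjReflect_conjReflect, map_neg, mul_assoc]
  · change PhiStar μ 0 = 1 - C (-1) * X * 0
    simp [PhiStar_zero]
  · change 1 = 1 - C 0 * X * 0
    simp

/-- On the unit disk `Φ_n^*` does not vanish and dominates `Φ_n`. -/
theorem PhiStar_ne_zero_and_norm_PhiInt_le [IsFiniteMeasure μ] (hμ : μ.support.Infinite) (m : ℤ)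
    {z : ℂ} (hz : ‖z‖ < 1) :
    (PhiStar μ m).eval z ≠ 0 ∧ ‖(PhiInt μ m).eval z‖ ≤ ‖(PhiStar μ m).eval z‖ := by
  obtain n | n := m
  · induction n with
    | zero =>
      rw [show Int.ofNat 0 = 0 from rfl, PhiStar_zero]
      simp [PhiInt, Phi_zero]
    | succ n ih =>
      obtain ⟨hne, hle⟩ := ih
      have ha := norm_verblunsky_le μ hμ (Int.ofNat n)
      have e1 := congrArg (eval z) (PhiStar_succ μ hμ (Int.ofNat n))
      have e2 := congrArg (eval z) (PhiInt_succ μ hμ (Int.ofNat n))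
      simp only [eval_sub, eval_mul, eval_C, eval_X] at e1 e2
      change (PhiStar μ (Int.ofNat (n + 1))).eval z = _ at e1
      change (PhiInt μ (Int.ofNat (n + 1))).eval z = _ at e2
      generalize verblunsky μ (Int.ofNat n) = a at *
      generalize (PhiStar μ (Int.ofNat n)).eval z = s at *
      generalize (PhiInt μ (Int.ofNat n)).eval z = p at *
      have hs : 0 < ‖s‖ := norm_pos_iff.2 hne
      -- Strictness comes from `‖z‖ < 1`, so the new `Φ^*` is nonzero even if `‖a‖ = 1`.
      have hzp : ‖z * p‖ < ‖s‖ := by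
        rw [norm_mul]
        calc ‖z‖ * ‖p‖ ≤ ‖z‖ * ‖s‖ := by gcongr
          _ < 1 * ‖s‖ := by gcongr
          _ = ‖s‖ := one_mul _
      have e3 : s - a * z * p = s - a * (z * p) := by ring
      rw [e1, e2, e3]
      generalize z * p = w at *
      constructor
      · intro h0
        rw [sub_eq_zero] at h0
        rw [h0, norm_mul] at hzp
        nlinarith [norm_nonneg w]
      · rw [← sq_le_sq₀ (norm_nonneg _) (norm_nonneg _)]
        have hid : ‖s - a * w‖ ^ 2 - ‖w - (starRingEnd ℂ) a * s‖ ^ 2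
            = (1 - ‖a‖ ^ 2) * (‖s‖ ^ 2 - ‖w‖ ^ 2) := by
          simp only [← Complex.normSq_eq_norm_sq, Complex.normSq_apply, Complex.sub_re,
            Complex.sub_im, Complex.mul_re, Complex.mul_im, Complex.conj_re, Complex.conj_im]
          ring
        have h1 : 0 ≤ 1 - ‖a‖ ^ 2 := by nlinarith [norm_nonneg a]
        have h2 : 0 ≤ ‖s‖ ^ 2 - ‖w‖ ^ 2 := by nlinarith [norm_nonneg w]
        nlinarith [mul_nonneg h1 h2]
  · simp [PhiStar, PhiInt]

theorem differentiableOn_ratio [IsFiniteMeasure μ] (hμ : μ.support.Infinite) (m : ℤ) :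
    DifferentiableOn ℂ (ratio μ m) (Metric.ball 0 1) := by
  refine DifferentiableOn.div (Polynomial.differentiable _).differentiableOn
    (Polynomial.differentiable _).differentiableOn fun z hz => ?_
  exact (PhiStar_ne_zero_and_norm_PhiInt_le μ hμ m (by simpa using hz)).1

theorem norm_ratio_le [IsFiniteMeasure μ] (hμ : μ.support.Infinite) (m : ℤ) {z : ℂ}
    (hz : z ∈ Metric.ball (0 : ℂ) 1) : ‖ratio μ m z‖ ≤ 2 := by
  have hz' : ‖z‖ < 1 := by simpa using hz
  obtain ⟨hne, hle⟩ := PhiStar_ne_zero_and_norm_PhiInt_le μ hμ m hz'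
  have ha := norm_verblunsky_le μ hμ m
  rw [ratio, norm_div, div_le_iff₀ (norm_pos_iff.2 hne), PhiStar_succ μ hμ]
  simp only [eval_sub, eval_mul, eval_C, eval_X]
  refine (norm_sub_le _ _).trans ?_
  rw [norm_mul, norm_mul]
  have : ‖verblunsky μ m‖ * ‖z‖ * ‖(PhiInt μ m).eval z‖ ≤ 1 * 1 * ‖(PhiStar μ m).eval z‖ := by
    gcongr
  linarith

/-- This moves the analytic quotient into formal power series, where the rest of the argument takes
place. -/
theorem taylorSeries_ratio_mul [IsFiniteMeasure μ] (hμ : μ.support.Infinite) (m : ℤ) :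
    taylorSeries (ratio μ m) * (PhiStar μ m : PowerSeries ℂ)
      = (PhiStar μ (m + 1) : PowerSeries ℂ) := by
  have h0 : Metric.ball (0 : ℂ) 1 ∈ 𝓝 (0 : ℂ) := Metric.ball_mem_nhds 0 one_pos
  rw [← taylorSeries_eval, ← taylorSeries_eval, ← taylorSeries_mul]
  · refine taylorSeries_congr ?_
    filter_upwards [h0] with z hz
    exact div_mul_cancel₀ _ (PhiStar_ne_zero_and_norm_PhiInt_le μ hμ m (by simpa using hz)).1
  · exact (differentiableOn_ratio μ hμ m).analyticAt h0
  · exact (Polynomial.differentiable _).analyticAt 0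

/-! ### Taylor coefficients of the ratios in terms of Verblunsky products. -/

/-- Iterating Szegő's recursion. -/
theorem PhiInt_eq_sum [IsFiniteMeasure μ] (hμ : μ.support.Infinite) (m : ℤ) (L : ℕ) :
    PhiInt μ m = X ^ L * PhiInt μ (m - L) - ∑ i ∈ Finset.range L,
      C ((starRingEnd ℂ) (verblunsky μ (m - (i + 1 : ℕ)))) * X ^ i * PhiStar μ (m - (i + 1 : ℕ)) := by
  induction L with
  | zero => simp
  | succ L ih =>
    have h := PhiInt_succ μ hμ (m - (L + 1 : ℕ))
    rw [show m - ((L + 1 : ℕ) : ℤ) + 1 = m - L by push_cast; ring] at h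
    rw [Finset.sum_range_succ]
    conv_lhs => rw [ih, h]
    ring

/-- The coefficients of degree at most `L` of the power series `F n` converge as `n → ∞`. -/
def CoeffConverge (L : ℕ) (F : ℕ → PowerSeries ℂ) : Prop :=
  ∀ i ≤ L, ∃ c, Tendsto (fun n => PowerSeries.coeff i (F n)) atTop (𝓝 c)

theorem exists_tendsto_sum {ι : Type*} (s : Finset ι) (u : ι → ℕ → ℂ)
    (h : ∀ i ∈ s, ∃ c, Tendsto (u i) atTop (𝓝 c)) :
    ∃ c, Tendsto (fun n => ∑ i ∈ s, u i n) atTop (𝓝 c) := by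
  choose! c hc using h
  exact ⟨_, tendsto_finsetSum s hc⟩

theorem exists_tendsto_mul {u v : ℕ → ℂ} (hu : ∃ c, Tendsto u atTop (𝓝 c))
    (hv : ∃ c, Tendsto v atTop (𝓝 c)) : ∃ c, Tendsto (fun n => u n * v n) atTop (𝓝 c) := by
  obtain ⟨a, ha⟩ := hu
  obtain ⟨b, hb⟩ := hv
  exact ⟨a * b, ha.mul hb⟩

/-- Division of power series preserves convergence of coefficients. -/
theorem CoeffConverge.of_mul {L : ℕ} {A B : ℕ → PowerSeries ℂ}
    (hB : CoeffConverge L B) (hB0 : ∀ n, PowerSeries.coeff 0 (B n) = 1)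
    (hAB : CoeffConverge L fun n => A n * B n) : CoeffConverge L A := by
  intro i
  induction i using Nat.strong_induction_on with
  | _ i ih =>
    intro hi
    -- As `B n` has constant term 1, the top term of the Cauchy product is the `i`-th coefficient of
    -- `A n` itself.
    have hform : ∀ n, PowerSeries.coeff i (A n) = PowerSeries.coeff i (A n * B n) -
        ∑ p ∈ Finset.range i, PowerSeries.coeff p (A n) * PowerSeries.coeff (i - p) (B n) := by
      intro n
      rw [PowerSeries.coeff_mul, Finset.Nat.sum_antidiagonal_eq_sum_range_succ_mk,
        Finset.sum_range_succ, Nat.sub_self, hB0]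
      ring
    obtain ⟨a, ha⟩ := hAB i hi
    obtain ⟨b, hb⟩ := exists_tendsto_sum (Finset.range i)
      (fun p n => PowerSeries.coeff p (A n) * PowerSeries.coeff (i - p) (B n))
      (fun p hp => exists_tendsto_mul
        (ih p (Finset.mem_range.1 hp) ((Finset.mem_range.1 hp).le.trans hi))
        (hB _ ((Nat.sub_le _ _).trans hi)))
    refine ⟨a - b, ?_⟩
    simp only [hform]
    exact ha.sub hb

/-- The Taylor expansion of `Φ_{m-ℓ}^* / Φ_m^*` at the origin. -/
noncomputable def backwardQuotient (m : ℤ) (ℓ : ℕ) : PowerSeries ℂ :=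
  (PhiStar μ (m - ℓ) : PowerSeries ℂ) * (PhiStar μ m : PowerSeries ℂ)⁻¹

theorem constantCoeff_PhiStar (m : ℤ) :
    PowerSeries.constantCoeff (PhiStar μ m : PowerSeries ℂ) = 1 := by
  rw [← PowerSeries.coeff_zero_eq_constantCoeff_apply, Polynomial.coeff_coe, coeff_zero_PhiStar]

theorem PhiStar_mul_inv (m : ℤ) :
    (PhiStar μ m : PowerSeries ℂ) * (PhiStar μ m : PowerSeries ℂ)⁻¹ = 1 :=
  PowerSeries.mul_inv_cancel _ (by rw [constantCoeff_PhiStar]; exact one_ne_zero)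

theorem coeff_zero_backwardQuotient (m : ℤ) (ℓ : ℕ) :
    PowerSeries.coeff 0 (backwardQuotient μ m ℓ) = 1 := by
  rw [PowerSeries.coeff_zero_eq_constantCoeff_apply, backwardQuotient, map_mul,
    PowerSeries.constantCoeff_inv, constantCoeff_PhiStar, constantCoeff_PhiStar]
  simp

section

variable [IsFiniteMeasure μ] (hμ : μ.support.Infinite)
include hμ

theorem coeff_zero_taylorSeries_ratio (m : ℤ) :
    PowerSeries.coeff 0 (taylorSeries (ratio μ m)) = 1 := by
  have h := congrArg PowerSeries.constantCoeff (taylorSeries_ratio_mul μ hμ m)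
  rw [map_mul, constantCoeff_PhiStar, constantCoeff_PhiStar, mul_one] at h
  rw [PowerSeries.coeff_zero_eq_constantCoeff_apply, h]

theorem backwardQuotient_succ_mul (m : ℤ) (ℓ : ℕ) :
    backwardQuotient μ m (ℓ + 1) * taylorSeries (ratio μ (m - (ℓ + 1 : ℕ))) =
      backwardQuotient μ m ℓ := by
  have h := taylorSeries_ratio_mul μ hμ (m - (ℓ + 1 : ℕ))
  rw [show m - ((ℓ + 1 : ℕ) : ℤ) + 1 = m - ℓ by push_cast; ring] at h
  rw [backwardQuotient, backwardQuotient, ← h]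
  ring

/-- Substitute the iterated recursion for `Φ_m` into `Φ_{m+1}^* = Φ_m^* - α_m z Φ_m` and divide by
`Φ_m^*`. The remainder carries `X ^ (L + 1)`, so it does not affect coefficients up to order `L`. -/
theorem taylorSeries_ratio_eq (m : ℤ) (L : ℕ) :
    taylorSeries (ratio μ m) = 1 + (∑ i ∈ Finset.range L, PowerSeries.X ^ (i + 1) *
        (PowerSeries.C (verblunsky μ m * (starRingEnd ℂ) (verblunsky μ (m - (i + 1 : ℕ)))) *
          backwardQuotient μ m (i + 1)))
      - PowerSeries.X ^ (L + 1) * (PowerSeries.C (verblunsky μ m) *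
          (PhiInt μ (m - L) : PowerSeries ℂ) * (PhiStar μ m : PowerSeries ℂ)⁻¹) := by
  have hpoly : PhiStar μ (m + 1) = PhiStar μ m + (∑ i ∈ Finset.range L, X ^ (i + 1) *
        (C (verblunsky μ m * (starRingEnd ℂ) (verblunsky μ (m - (i + 1 : ℕ)))) *
          PhiStar μ (m - (i + 1 : ℕ))))
      - X ^ (L + 1) * (C (verblunsky μ m) * PhiInt μ (m - L)) := by
    have hsum : (∑ i ∈ Finset.range L, X ^ (i + 1) *
        (C (verblunsky μ m * (starRingEnd ℂ) (verblunsky μ (m - (i + 1 : ℕ)))) *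
          PhiStar μ (m - (i + 1 : ℕ)))) = C (verblunsky μ m) * X * ∑ i ∈ Finset.range L,
        C ((starRingEnd ℂ) (verblunsky μ (m - (i + 1 : ℕ)))) * X ^ i *
          PhiStar μ (m - (i + 1 : ℕ)) := by
      rw [Finset.mul_sum]
      refine Finset.sum_congr rfl fun i _ => ?_
      rw [C_mul]
      ring
    rw [hsum, PhiStar_succ μ hμ]
    conv_lhs => rw [PhiInt_eq_sum μ hμ m L]
    ring
  have h := taylorSeries_ratio_mul μ hμ m
  rw [hpoly] at h
  have h1 : taylorSeries (ratio μ m) = taylorSeries (ratio μ m) * (PhiStar μ m : PowerSeries ℂ) *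
      (PhiStar μ m : PowerSeries ℂ)⁻¹ := by
    rw [mul_assoc, PhiStar_mul_inv, mul_one]
  rw [h1, h]
  have hcast : ∀ s : Finset ℕ, ∀ f : ℕ → ℂ[X],
      ((∑ i ∈ s, f i : ℂ[X]) : PowerSeries ℂ) = ∑ i ∈ s, (f i : PowerSeries ℂ) := fun s f =>
    map_sum (Polynomial.coeToPowerSeries.ringHom (R := ℂ)) f s
  simp only [Polynomial.coe_sub, Polynomial.coe_add, Polynomial.coe_mul, Polynomial.coe_pow,
    Polynomial.coe_X, Polynomial.coe_C, hcast, sub_mul, add_mul, PhiStar_mul_inv, Finset.sum_mul,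
    mul_assoc, backwardQuotient]

/-- The Taylor coefficients of `Ω_m` in terms of the products `α_m conj α_{m-ℓ}`. -/
theorem coeff_succ_taylorSeries_ratio (m : ℤ) (L : ℕ) :
    PowerSeries.coeff (L + 1) (taylorSeries (ratio μ m)) =
      verblunsky μ m * (starRingEnd ℂ) (verblunsky μ (m - (L + 1 : ℕ))) +
      ∑ i ∈ Finset.range L, verblunsky μ m * (starRingEnd ℂ) (verblunsky μ (m - (i + 1 : ℕ))) *
        PowerSeries.coeff (L - i) (backwardQuotient μ m (i + 1)) := by
  -- With `L + 1` terms the remainder starts at order `L + 2`; the term `i = L` contributes its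
  -- constant coefficient, the bare product.
  rw [taylorSeries_ratio_eq μ hμ m (L + 1), map_sub, map_add, map_sum, Finset.sum_range_succ,
    PowerSeries.coeff_X_pow_mul', if_pos le_rfl, PowerSeries.coeff_X_pow_mul', if_neg (by omega),
    Nat.sub_self, PowerSeries.coeff_C_mul, coeff_zero_backwardQuotient, PowerSeries.coeff_one,
    if_neg (by omega), mul_one, sub_zero, zero_add, add_comm]
  congr 1
  refine Finset.sum_congr rfl fun i hi => ?_
  have hi' := Finset.mem_range.1 hi
  rw [PowerSeries.coeff_X_pow_mul', if_pos (by omega), PowerSeries.coeff_C_mul,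
    Nat.add_sub_add_right]

/-- The quotient `Φ_{m-ℓ}^* / Φ_m^*` arises by dividing 1 successively by `Ω_{m-1}, …, Ω_{m-ℓ}`, and
each division preserves convergence. -/
theorem CoeffConverge.backwardQuotient {L : ℕ} {m : ℕ → ℤ}
    (h : ∀ ℓ : ℕ, CoeffConverge L fun n => taylorSeries (ratio μ (m n - (ℓ + 1 : ℕ)))) (ℓ : ℕ) :
    CoeffConverge L fun n => backwardQuotient μ (m n) ℓ := by
  induction ℓ with
  | zero =>
    intro i _
    simp only [OPUC.backwardQuotient, Nat.cast_zero, sub_zero, PhiStar_mul_inv]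
    exact ⟨_, tendsto_const_nhds⟩
  | succ ℓ ih =>
    refine CoeffConverge.of_mul (h ℓ) (fun n => coeff_zero_taylorSeries_ratio μ hμ _) ?_
    simpa only [backwardQuotient_succ_mul μ hμ] using ih

/-- The inductive step: under the hypotheses of lower order, the two sequences differ by a
convergent one. -/
theorem exists_tendsto_coeff_succ_iff {L : ℕ} {m : ℕ → ℤ}
    (h : ∀ ℓ : ℕ, CoeffConverge L fun n => taylorSeries (ratio μ (m n - (ℓ + 1 : ℕ))))
    (hα : ∀ i < L, ∃ c, Tendsto (fun n => verblunsky μ (m n) *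
      (starRingEnd ℂ) (verblunsky μ (m n - (i + 1 : ℕ)))) atTop (𝓝 c)) :
    (∃ c, Tendsto (fun n => PowerSeries.coeff (L + 1) (taylorSeries (ratio μ (m n)))) atTop (𝓝 c))
      ↔ ∃ c, Tendsto (fun n => verblunsky μ (m n) *
        (starRingEnd ℂ) (verblunsky μ (m n - (L + 1 : ℕ)))) atTop (𝓝 c) := by
  obtain ⟨b, hb⟩ := exists_tendsto_sum (Finset.range L)
    (fun i n => verblunsky μ (m n) * (starRingEnd ℂ) (verblunsky μ (m n - (i + 1 : ℕ))) *
        PowerSeries.coeff (L - i) (OPUC.backwardQuotient μ (m n) (i + 1)))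
    (fun i hi => exists_tendsto_mul (hα i (Finset.mem_range.1 hi))
      (CoeffConverge.backwardQuotient μ hμ h (i + 1) _ (Nat.sub_le _ _)))
  simp only [coeff_succ_taylorSeries_ratio μ hμ]
  constructor
  · rintro ⟨c, hc⟩
    exact ⟨c - b, by simpa using hc.sub hb⟩
  · rintro ⟨c, hc⟩
    exact ⟨c + b, hc.add hb⟩

theorem convergesOnCompacts_ratio_iff (m : ℕ → ℤ) :
    ConvergesOnCompacts (fun n => ratio μ (m n)) ↔
      ∀ i, ∃ c, Tendsto (fun n => PowerSeries.coeff i (taylorSeries (ratio μ (m n)))) atTop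
        (𝓝 c) :=
  ⟨fun h => h.tendsto_coeff fun n => differentiableOn_ratio μ hμ (m n),
    convergesOnCompacts_of_tendsto_coeff (fun n => differentiableOn_ratio μ hμ (m n))
      fun n _ hz => norm_ratio_le μ hμ (m n) hz⟩

end

end OPUC

/-! ### The equivalence, by induction on the order of the coefficient. -/

theorem theorem4p3 (μ : Measure OPUC.UnitCircle) [IsProbabilityMeasure μ] (hμ : μ.support.Infinite)
    (j : ℕ → ℤ) (hj : Monotone j) (k' : WithTop ℤ) :
    (∀ k : ℤ, (k : WithTop ℤ) < k' →
      OPUC.ConvergesOnCompacts (fun n z => OPUC.ratio μ (k + j n) z)) ↔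
    (∀ ℓ : ℕ, 1 ≤ ℓ → ∀ k : ℤ, (k : WithTop ℤ) < k' →
      ∃ c ∈ Metric.closedBall (0 : ℂ) 1,
        Tendsto (fun n : ℕ => OPUC.verblunsky μ (k + j n) *
          (starRingEnd ℂ) (OPUC.verblunsky μ (k + j n - (ℓ : ℤ)))) atTop (𝓝 c)) := by
  have hshift : ∀ k : ℤ, ∀ ℓ : ℕ, (k : WithTop ℤ) < k' → ((k - ℓ : ℤ) : WithTop ℤ) < k' :=
    fun k ℓ hk => lt_of_le_of_lt (WithTop.coe_le_coe.2 (by omega)) hk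
  have hstep : ∀ L : ℕ,
      (∀ i ≤ L, ∀ k : ℤ, (k : WithTop ℤ) < k' → ∃ c, Tendsto (fun n =>
        PowerSeries.coeff i (OPUC.taylorSeries (OPUC.ratio μ (k + j n)))) atTop (𝓝 c)) →
      (∀ i < L, ∀ k : ℤ, (k : WithTop ℤ) < k' → ∃ c, Tendsto (fun n => OPUC.verblunsky μ (k + j n) *
        (starRingEnd ℂ) (OPUC.verblunsky μ (k + j n - (i + 1 : ℕ)))) atTop (𝓝 c)) →
      ∀ k : ℤ, (k : WithTop ℤ) < k' → ((∃ c, Tendsto (fun n =>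
        PowerSeries.coeff (L + 1) (OPUC.taylorSeries (OPUC.ratio μ (k + j n)))) atTop (𝓝 c)) ↔
        ∃ c, Tendsto (fun n => OPUC.verblunsky μ (k + j n) *
          (starRingEnd ℂ) (OPUC.verblunsky μ (k + j n - (L + 1 : ℕ)))) atTop (𝓝 c)) := by
    intro L hT hα k hk
    refine OPUC.exists_tendsto_coeff_succ_iff μ hμ (m := fun n => k + j n) (fun ℓ i hi => ?_)
      (fun i hi => hα i hi k hk)
    simpa only [sub_add_eq_add_sub] using hT i hi (k - (ℓ + 1 : ℕ)) (hshift k (ℓ + 1) hk)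
  constructor
  · intro h ℓ hℓ
    have hT : ∀ i, ∀ k : ℤ, (k : WithTop ℤ) < k' → ∃ c, Tendsto (fun n =>
        PowerSeries.coeff i (OPUC.taylorSeries (OPUC.ratio μ (k + j n)))) atTop (𝓝 c) :=
      fun i k hk => (OPUC.convergesOnCompacts_ratio_iff μ hμ fun n => k + j n).1 (h k hk) i
    have hα : ∀ L : ℕ, ∀ k : ℤ, (k : WithTop ℤ) < k' →
        ∃ c, Tendsto (fun n => OPUC.verblunsky μ (k + j n) *
          (starRingEnd ℂ) (OPUC.verblunsky μ (k + j n - (L + 1 : ℕ)))) atTop (𝓝 c) := by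
      intro L
      induction L using Nat.strong_induction_on with
      | _ L ih => exact fun k hk => (hstep L (fun i _ => hT i) ih k hk).1 (hT (L + 1) k hk)
    intro k hk
    obtain ⟨L, rfl⟩ := Nat.exists_eq_add_of_le' hℓ
    obtain ⟨c, hc⟩ := hα L k hk
    refine ⟨c, ?_, hc⟩
    rw [mem_closedBall_zero_iff]
    refine le_of_tendsto hc.norm (Eventually.of_forall fun n => ?_)
    rw [norm_mul, RCLike.norm_conj]
    exact mul_le_one₀ (OPUC.norm_verblunsky_le μ hμ _) (norm_nonneg _)
      (OPUC.norm_verblunsky_le μ hμ _)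
  · intro h k hk
    refine (OPUC.convergesOnCompacts_ratio_iff μ hμ fun n => k + j n).2 fun i => ?_
    have hα : ∀ L : ℕ, ∀ k : ℤ, (k : WithTop ℤ) < k' →
        ∃ c, Tendsto (fun n => OPUC.verblunsky μ (k + j n) *
          (starRingEnd ℂ) (OPUC.verblunsky μ (k + j n - (L + 1 : ℕ)))) atTop (𝓝 c) := by
      intro L k hk
      obtain ⟨c, -, hc⟩ := h (L + 1) (by omega) k hk
      exact ⟨c, hc⟩
    -- `k` must vary, since the coefficient of order `i` at `k` depends on lower coefficients at
    -- smaller indices.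
    induction i using Nat.strong_induction_on generalizing k with
    | _ i ih =>
      obtain _ | L := i
      · simp only [OPUC.coeff_zero_taylorSeries_ratio μ hμ]
        exact ⟨1, tendsto_const_nhds⟩
      · exact (hstep L (fun i hi k hk => ih i (by omega) k hk) (fun i _ => hα i) k hk).2
          (hα L k hk)
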